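/- For every real number $\varepsilon_0<1$ there is a constant $c>0$, depending only on $\varepsilon_0$, such that the following holds. Write $\lg=\log_2$. For all integers $n,d\ge 2$ and every real $\varepsilon$ with $$\frac{(\lg n)^{0.5001}}{\sqrt{\min\{n,d\}}}<\varepsilon\le\varepsilon_0,$$ there exists a set $X\subset\mathbb{R}^d$ of exactly $n$ points such that, for every integer $m\ge 0$ and every (not necessarily linear) map $f:X\to\mathbb{R}^m$ satisfying $$(1-\varepsilon)\|x-y\|_2^2\le\|f(x)-f(y)\|_2^2\le(1+\varepsilon)\|x-y\|_2^2\qquad\text{for all }x,y\in X,$$ one has $$m\ \ge\ c\,\varepsilon^{-2}\lg(\varepsilon^2 n).$$ In other words, $m=\Omega(\varepsilon^{-2}\lg(\varepsilon^2n))$ for $\varepsilon\in\big((\lg n)^{0.5001}/\sqrt{\min\{n,d\}},\,1\big)$, with an implied constant that is uniform as long as $\varepsilon$ stays bounded away from $1$. -/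

import Mathlib

/-- `PreservesDistances X ε f`: the map `f : X → ℝ^m` preserves all squared pairwise Euclidean
distances of the finite point set `X ⊂ ℝ^d` within a factor `1 ± ε`. -/
def PreservesDistances {d m : ℕ} (X : Finset (EuclideanSpace ℝ (Fin d))) (ε : ℝ)
    (f : X → EuclideanSpace ℝ (Fin m)) : Prop :=
  ∀ x y : X,
    (1 - ε) * ‖(x : EuclideanSpace ℝ (Fin d)) - (y : EuclideanSpace ℝ (Fin d))‖ ^ 2
        ≤ ‖f x - f y‖ ^ 2 ∧
    ‖f x - f y‖ ^ 2
        ≤ (1 + ε) * ‖(x : EuclideanSpace ℝ (Fin d)) - (y : EuclideanSpace ℝ (Fin d))‖ ^ 2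

/-!
The lower bound is an encoding argument: there are more point sets of a certain
kind than embeddings into few dimensions can tell apart.

Suppose first that `ε ≤ 1 / 48`. Take `k ≈ ε⁻² / 2304` and `N ≈ n / (4 lg n)`. If `v 1, …, v N`
are almost orthonormal vectors of `ℝ^d` and `S` is a set of `k` indices, the inner product of
`y S = k ^ (-1/2) * ∑ i ∈ S, v i` with `v j` is about `k ^ (-1/2) ≥ 48 ε` if `j ∈ S`, and about
`0` otherwise. A map that preserves the distances among `0`, the `v j` and the `y S` preserves
these inner products up to `O(ε)` (`abs_inner_sub_inner_le`), so `S` can be recovered from the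
images. Orthonormal vectors would need `d ≥ N`; random sign vectors do for every `d` of order at
least `ε⁻² lg n`, at the price of discarding at most half of the sets `S`
(`exists_almost_orthonormal`).

The point set consists of `0`, the `v j`, and `Q = n / 2` vectors `y S`. If all these point sets
embed in `ℝ^M`, round the images of the `v j` to an `ε`-net, at a total cost of
`(5 / ε) ^ (M * N)` choices, which is at most `2 ^ (M * Q)`. Once these are fixed, each of the `Q`
sets is determined by the vector of inner products of the image of `y S` with the rounded images.
Such vectors lie in a cube of side comparable to `k ^ (-1/2)` intersected with a space of dimension
at most `M`, and differ in the sup norm by a constant fraction of `k ^ (-1/2)`, so a volume bound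
leaves only `6 ^ M` possible sets (`card_decodable_le`). This step avoids the factor `lg (1 / ε)`
that rounding the images of the `y S` to a net would lose. Hence (`card_pow_le_of_embeddings`) the
number of sets, at least `(N / (2 * k)) ^ k / 2`, is at most `12 ^ M`. As `N / k` is at least a
constant times `ε² n / lg n`, and this in turn exceeds a fixed power of `ε² n` because
`ε² n ≥ (lg n) ^ 1.0002`, one obtains `M ≥ c ε⁻² lg (ε² n)` (`lt_of_forall_embedding`).

For `1 / 48 < ε ≤ ε₀` the claim is `m ≥ c lg n`, which is a packing bound: `n` separated points of
a ball of bounded radius are mapped to separated points of a ball of bounded radius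
(`exists_hard_set_of_large`).
-/

/-! ### Packings and nets -/

section Packing

open MeasureTheory Metric
open scoped Pointwise

/-- Volume bound for packings with respect to a seminorm `p` on a finite-dimensional space: vectors
of seminorm at most `R` whose differences have seminorm at least `r` number at most
`(1 + 2R/r) ^ dim E`. The seminorm may vanish on a nontrivial subspace. -/
theorem card_le_of_seminorm_separated {E ι : Type*} [NormedAddCommGroup E] [NormedSpace ℝ E]
    [FiniteDimensional ℝ E] (p : Seminorm ℝ E) (hp : Continuous p) (s : Finset ι) (w : ι → E)
    {r R : ℝ} (hr : 0 < r) (hR : 0 < R) (hw : ∀ i ∈ s, p (w i) ≤ R)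
    (hsep : ∀ i ∈ s, ∀ j ∈ s, i ≠ j → r ≤ p (w i - w j)) :
    (s.card : ℝ) ≤ (1 + 2 * R / r) ^ Module.finrank ℝ E := by
  borelize E
  let μ : Measure E := Measure.addHaar
  -- Adding a small multiple of the norm of `E` makes the unit ball of the seminorm bounded.
  obtain ⟨W, hW0, hW⟩ : ∃ W : ℝ, 0 < W ∧ ∀ i ∈ s, ‖w i‖ ≤ W :=
    ⟨1 + ∑ i ∈ s, ‖w i‖, by positivity, fun i hi => by
      have := Finset.single_le_sum (f := fun i => ‖w i‖) (fun j _ => norm_nonneg _) hi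
      linarith⟩
  let ε : NNReal := ⟨R / W, by positivity⟩
  have hε : (0 : ℝ) < ε := div_pos hR hW0
  let q : Seminorm ℝ E := p ⊔ ε • normSeminorm ℝ E
  have hqa : ∀ x, q x = max (p x) (ε * ‖x‖) := fun x => rfl
  have hqR : ∀ i ∈ s, q (w i) ≤ R := fun i hi => by
    rw [hqa]
    refine max_le (hw i hi) ?_
    calc R / W * ‖w i‖ ≤ R / W * W := by gcongr; exact hW i hi
      _ = R := by field_simp
  have hqr : ∀ i ∈ s, ∀ j ∈ s, i ≠ j → r ≤ q (w i - w j) := fun i hi j hj hij => by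
    rw [hqa]
    exact (hsep i hi j hj hij).trans (le_max_left _ _)
  have hqc : Continuous q := by
    have : (q : E → ℝ) = fun x => max (p x) (ε * ‖x‖) := funext hqa
    rw [this]
    fun_prop
  have hopen : ∀ (x : E) (ρ : ℝ), IsOpen (q.ball x ρ) := fun x ρ => by
    have : q.ball x ρ = (fun y => q (y - x)) ⁻¹' Set.Iio ρ := by
      ext y; simp [Seminorm.mem_ball]
    rw [this]
    exact isOpen_Iio.preimage (hqc.comp (by fun_prop))
  have hvol : ∀ (x : E) (ρ : ℝ), 0 < ρ →
      μ (q.ball x ρ) = ENNReal.ofReal (ρ ^ Module.finrank ℝ E) * μ (q.ball 0 1) := fun x ρ hρ => by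
    have h1 : q.ball x ρ = (fun y => y + (-x)) ⁻¹' q.ball 0 ρ := by
      ext y; simp [Seminorm.mem_ball, sub_eq_add_neg]
    have h2 : q.ball 0 ρ = ρ • q.ball 0 1 := by
      rw [Seminorm.smul_ball_zero hρ.ne']
      simp [abs_of_pos hρ]
    rw [h1, measure_preimage_add_right, h2, Measure.addHaar_smul_of_nonneg _ hρ.le]
  have hpos : μ (q.ball 0 1) ≠ 0 :=
    ((hopen 0 1).measure_pos μ ⟨0, by simp [Seminorm.mem_ball]⟩).ne'
  have hfin : μ (q.ball 0 1) ≠ ⊤ := by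
    refine ((measure_mono ?_).trans_lt (measure_ball_lt_top (μ := μ) (x := 0)
      (r := 1 / (ε : ℝ)))).ne
    intro y hy
    rw [Seminorm.mem_ball_zero, hqa] at hy
    rw [mem_ball_zero_iff, lt_div_iff₀ hε, mul_comm]
    exact (le_max_right _ _).trans_lt hy
  have hdisj : (s : Set ι).PairwiseDisjoint fun i => q.ball (w i) (r / 2) := by
    intro i hi j hj hij
    refine Set.disjoint_left.2 fun y hyi hyj => ?_
    rw [Seminorm.mem_ball] at hyi hyj
    have h1 := hqr i hi j hj hij
    have h2 : q (w i - w j) ≤ q (y - w j) + q (y - w i) := by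
      have : w i - w j = (y - w j) - (y - w i) := by abel
      rw [this]
      exact map_sub_le_add q _ _
    linarith
  have hsub : (⋃ i ∈ s, q.ball (w i) (r / 2)) ⊆ q.ball 0 (R + r / 2) := by
    intro y hy
    simp only [Set.mem_iUnion, exists_prop] at hy
    obtain ⟨i, hi, hy⟩ := hy
    rw [Seminorm.mem_ball] at hy
    rw [Seminorm.mem_ball_zero]
    have h2 : q y ≤ q (w i) + q (y - w i) := by
      have := map_add_le_add q (w i) (y - w i)
      rwa [add_sub_cancel] at this
    linarith [hqR i hi]
  have key := measure_mono (μ := μ) hsub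
  rw [measure_biUnion_finset hdisj fun i _ => (hopen _ _).measurableSet,
    Finset.sum_congr rfl fun i _ => hvol (w i) (r / 2) (by positivity),
    hvol 0 (R + r / 2) (by positivity), Finset.sum_const, nsmul_eq_mul, ← mul_assoc,
    ENNReal.mul_le_mul_iff_left hpos hfin, ← ENNReal.ofReal_natCast,
    ← ENNReal.ofReal_mul (by positivity), ENNReal.ofReal_le_ofReal_iff (by positivity)] at key
  have h3 : 1 + 2 * R / r = (R + r / 2) / (r / 2) := by field_simp; ring
  rw [h3, div_pow, le_div_iff₀ (by positivity)]
  exact key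

/-- A maximal `r`-separated subset of the ball of radius `R` is an `r`-net of that ball. -/
theorem exists_separated_net {E : Type*} [NormedAddCommGroup E] [NormedSpace ℝ E]
    [FiniteDimensional ℝ E] {r R : ℝ} (hr : 0 < r) (hR : 0 < R) :
    ∃ T : Finset E, (∀ x ∈ T, ‖x‖ ≤ R) ∧ (∀ x ∈ T, ∀ y ∈ T, x ≠ y → r ≤ ‖x - y‖) ∧
      (∀ x, ‖x‖ ≤ R → ∃ y ∈ T, ‖x - y‖ < r) ∧
      (T.card : ℝ) ≤ (1 + 2 * R / r) ^ Module.finrank ℝ E := by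
  classical
  let P : Finset E → Prop := fun T => (∀ x ∈ T, ‖x‖ ≤ R) ∧ ∀ x ∈ T, ∀ y ∈ T, x ≠ y → r ≤ ‖x - y‖
  have hcard : ∀ T, P T → (T.card : ℝ) ≤ (1 + 2 * R / r) ^ Module.finrank ℝ E := fun T hT =>
    card_le_of_seminorm_separated (normSeminorm ℝ E) continuous_norm T id hr hR hT.1 hT.2
  have hbdd : ∀ c, (∃ T, P T ∧ T.card = c) → c ≤ ⌊(1 + 2 * R / r) ^ Module.finrank ℝ E⌋₊ := by
    rintro c ⟨T, hT, rfl⟩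
    exact Nat.le_floor (hcard T hT)
  obtain ⟨T, hT, hmax⟩ : ∃ T, P T ∧ ∀ T', P T' → T'.card ≤ T.card := by
    have h0 : ∃ T, P T ∧ T.card = 0 := ⟨∅, by simp [P], rfl⟩
    obtain ⟨T, hT, hc⟩ := Nat.findGreatest_spec (P := fun c => ∃ T, P T ∧ T.card = c)
      (Nat.zero_le ⌊(1 + 2 * R / r) ^ Module.finrank ℝ E⌋₊) h0
    refine ⟨T, hT, fun T' hT' => hc ▸ ?_⟩
    exact Nat.le_findGreatest (hbdd _ ⟨T', hT', rfl⟩) ⟨T', hT', rfl⟩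
  refine ⟨T, hT.1, hT.2, fun x hx => ?_, hcard T hT⟩
  by_contra! hcon
  have hxT : x ∉ T := fun h => by
    have := hcon x h
    simp only [sub_self, norm_zero] at this
    linarith
  have hP : P (insert x T) := by
    refine ⟨fun y hy => ?_, fun y hy z hz hyz => ?_⟩
    · rcases Finset.mem_insert.1 hy with rfl | hy
      · exact hx
      · exact hT.1 y hy
    · rcases Finset.mem_insert.1 hy with hyx | hy <;> rcases Finset.mem_insert.1 hz with hzx | hz
      · exact absurd (hyx.trans hzx.symm) hyz
      · rw [hyx]; exact hcon z hz
      · rw [hzx, norm_sub_rev]; exact hcon y hy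
      · exact hT.2 y hy z hz hyz
  have := hmax _ hP
  rw [Finset.card_insert_of_notMem hxT] at this
  omega

/-- The ball of radius `2` contains `2 ^ dim E` points at mutual distance at least `1`, because its
volume is `2 ^ dim E` times that of a unit ball. -/
theorem exists_separated_card_ge (E : Type*) [NormedAddCommGroup E] [NormedSpace ℝ E]
    [FiniteDimensional ℝ E] :
    ∃ T : Finset E, (∀ x ∈ T, ‖x‖ ≤ 2) ∧ (∀ x ∈ T, ∀ y ∈ T, x ≠ y → 1 ≤ ‖x - y‖) ∧
      2 ^ Module.finrank ℝ E ≤ T.card := by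
  borelize E
  let μ : Measure E := Measure.addHaar
  obtain ⟨T, hT1, hT2, hT3, -⟩ := exists_separated_net (E := E) one_pos two_pos
  refine ⟨T, hT1, hT2, ?_⟩
  have hsub : closedBall (0 : E) 2 ⊆ ⋃ y ∈ T, ball y 1 := fun x hx => by
    obtain ⟨y, hy, hxy⟩ := hT3 x (by simpa using hx)
    simp only [Set.mem_iUnion, exists_prop]
    exact ⟨y, hy, by simpa [dist_eq_norm] using hxy⟩
  have key := (measure_mono (μ := μ) hsub).trans (measure_biUnion_finset_le T _)
  have h1 : ∀ y : E, μ (ball y 1) = μ (ball 0 1) := fun y => Measure.addHaar_ball_center μ y 1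
  rw [Measure.addHaar_closedBall μ _ (by norm_num : (0 : ℝ) ≤ 2),
    Finset.sum_congr rfl fun y _ => h1 y, Finset.sum_const, nsmul_eq_mul,
    ENNReal.mul_le_mul_iff_left (measure_ball_pos μ 0 one_pos).ne' measure_ball_lt_top.ne,
    ← ENNReal.ofReal_natCast, ENNReal.ofReal_le_ofReal_iff (by positivity)] at key
  exact_mod_cast key

end Packing

/-! ### Random sign vectors -/

/-- Exponential moment of the inner product of row `j` of a uniformly random sign matrix with the
sum of the rows in `A`, where `j ∉ A`: it is at most that of a Gaussian of variance `|A| |κ|`. -/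
theorem sum_exp_sign_correlation_le {ι κ : Type*} [Fintype ι] [DecidableEq ι] [Fintype κ]
    [DecidableEq κ] (j : ι) (A : Finset ι) (hj : j ∉ A) (l : ℝ) :
    ∑ σ : ι → κ → ℤˣ, Real.exp (l * ∑ i ∈ A, ∑ c, ((σ i c * σ j c : ℤˣ) : ℝ)) ≤
      Real.exp (l ^ 2 / 2 * (A.card * Fintype.card κ)) * Fintype.card (ι → κ → ℤˣ) := by
  -- Multiplying all other rows by row `j` is a bijection, and makes the summands independent.
  let e : (ι → κ → ℤˣ) → ι → κ → ℤˣ := fun σ i c => if i = j then σ i c else σ i c * σ j c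
  have he : Function.Involutive e := fun σ => by
    funext i c
    by_cases h : i = j <;> simp [e, h, mul_assoc]
  have h1 : ∀ σ : ι → κ → ℤˣ, Real.exp (l * ∑ i ∈ A, ∑ c, ((σ i c * σ j c : ℤˣ) : ℝ)) =
      ∏ i, ∏ c, Real.exp (if i ∈ A then l * (e σ i c : ℤˣ) else 0) := fun σ => by
    simp only [← Real.exp_sum]
    congr 1
    rw [Finset.mul_sum, ← Finset.sum_filter_add_sum_filter_not Finset.univ (· ∈ A)]
    rw [Finset.sum_eq_zero (s := Finset.univ.filter (· ∉ A)), add_zero]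
    · rw [Finset.filter_univ_mem]
      refine Finset.sum_congr rfl fun i hi => ?_
      have : i ≠ j := fun h => hj (h ▸ hi)
      simp [hi, e, this, Finset.mul_sum]
    · intro i hi
      simp [(Finset.mem_filter.1 hi).2]
  rw [Finset.sum_congr rfl fun σ _ => h1 σ]
  have hcomp := Equiv.sum_comp he.toPerm
    (fun τ : ι → κ → ℤˣ => ∏ i, ∏ c, Real.exp (if i ∈ A then l * (τ i c : ℤˣ) else 0))
  simp only [Function.Involutive.coe_toPerm] at hcomp
  rw [hcomp, ← Fintype.prod_sum
    (fun i (x : κ → ℤˣ) => ∏ c, Real.exp (if i ∈ A then l * (x c : ℤˣ) else 0))]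
  have h2 : ∀ i, ∑ x : κ → ℤˣ, ∏ c, Real.exp (if i ∈ A then l * (x c : ℤˣ) else 0) ≤
      (if i ∈ A then Real.exp (l ^ 2 / 2) ^ Fintype.card κ else 1) * 2 ^ Fintype.card κ := by
    intro i
    rw [← Fintype.prod_sum (fun (_ : κ) (x : ℤˣ) => Real.exp (if i ∈ A then l * (x : ℤˣ) else 0)),
      Finset.prod_const, Finset.card_univ]
    by_cases h : i ∈ A
    · simp only [h, if_true, ← mul_pow]
      gcongr
      have := Real.cosh_le_exp_half_sq l
      rw [Real.cosh_eq] at this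
      simp [UnitsInt.univ]
      linarith
    · simp [h, UnitsInt.univ, one_add_one_eq_two]
  refine (Finset.prod_le_prod (fun i _ => Finset.sum_nonneg fun x _ =>
    Finset.prod_nonneg fun c _ => (Real.exp_pos _).le) fun i _ => h2 i).trans_eq ?_
  rw [Finset.prod_mul_distrib, Finset.prod_ite, Finset.prod_const_one, mul_one,
    Finset.filter_univ_mem, Finset.prod_const, Finset.prod_const, Finset.card_univ,
    Fintype.card_fun, Fintype.card_fun, ← pow_mul, ← Real.exp_nat_mul]
  push_cast
  rw [Fintype.card_units_int]
  push_cast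
  congr 2
  ring

/-- Hoeffding's inequality, in counting form: few sign matrices have a row `j` that correlates with
the sum of the rows in `A`. -/
theorem card_sign_correlation_le {ι κ : Type*} [Fintype ι] [DecidableEq ι] [Fintype κ]
    [DecidableEq κ] (j : ι) (A : Finset ι) (hj : j ∉ A) {t a : ℝ} (ht : 0 ≤ t) (ha : 0 < a)
    (hA : (A.card : ℝ) * Fintype.card κ ≤ a) :
    ((Finset.univ.filter fun σ : ι → κ → ℤˣ =>
      t ≤ |∑ i ∈ A, ∑ c, ((σ i c * σ j c : ℤˣ) : ℝ)|).card : ℝ) ≤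
      2 * Real.exp (-(t ^ 2 / (2 * a))) * Fintype.card (ι → κ → ℤˣ) := by
  set X : (ι → κ → ℤˣ) → ℝ := fun σ => ∑ i ∈ A, ∑ c, ((σ i c * σ j c : ℤˣ) : ℝ) with hX
  have hside : ∀ s : ℝ, s ^ 2 = 1 →
      ((Finset.univ.filter fun σ : ι → κ → ℤˣ => t ≤ s * X σ).card : ℝ) ≤
      Real.exp (-(t ^ 2 / (2 * a))) * Fintype.card (ι → κ → ℤˣ) := by
    intro s hs
    have h1 := sum_exp_sign_correlation_le (κ := κ) j A hj (s * t / a)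
    have h2 : ((Finset.univ.filter fun σ : ι → κ → ℤˣ => t ≤ s * X σ).card : ℝ) *
        Real.exp (t ^ 2 / a) ≤ ∑ σ, Real.exp (s * t / a * X σ) := by
      rw [← nsmul_eq_mul]
      refine (Finset.card_nsmul_le_sum _ (fun σ => Real.exp (s * t / a * X σ)) _ ?_).trans
        (Finset.sum_le_sum_of_subset_of_nonneg (Finset.filter_subset _ _)
          fun _ _ _ => (Real.exp_pos _).le)
      intro σ hσ
      have hσ := (Finset.mem_filter.1 hσ).2
      gcongr
      calc t ^ 2 / a = t / a * t := by ring
        _ ≤ t / a * (s * X σ) := by gcongr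
        _ = s * t / a * X σ := by ring
    have h3 : Real.exp ((s * t / a) ^ 2 / 2 * (A.card * Fintype.card κ)) ≤
        Real.exp (t ^ 2 / (2 * a)) := by
      gcongr
      calc (s * t / a) ^ 2 / 2 * (A.card * Fintype.card κ) ≤ (s * t / a) ^ 2 / 2 * a := by gcongr
        _ = s ^ 2 * (t ^ 2 / (2 * a)) := by field_simp
        _ = t ^ 2 / (2 * a) := by rw [hs, one_mul]
    have h4 : Real.exp (t ^ 2 / a) =
        Real.exp (t ^ 2 / (2 * a)) * Real.exp (t ^ 2 / (2 * a)) := by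
      rw [← Real.exp_add]; congr 1; field_simp; ring
    rw [Real.exp_neg, ← div_eq_inv_mul, le_div_iff₀ (Real.exp_pos _)]
    have h5 := h2.trans (h1.trans (mul_le_mul_of_nonneg_right h3 (Nat.cast_nonneg _)))
    rw [h4, ← mul_assoc, mul_comm (Real.exp (t ^ 2 / (2 * a))) (Fintype.card _ : ℝ)] at h5
    exact le_of_mul_le_mul_right h5 (Real.exp_pos _)
  have hsub : (Finset.univ.filter fun σ : ι → κ → ℤˣ => t ≤ |X σ|) ⊆
      (Finset.univ.filter fun σ => t ≤ 1 * X σ) ∪ Finset.univ.filter fun σ => t ≤ -1 * X σ := by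
    intro σ hσ
    have hσ := (Finset.mem_filter.1 hσ).2
    rcases le_abs.1 hσ with h | h <;> simp [h]
  have h := (Finset.card_le_card hsub).trans (Finset.card_union_le _ _)
  have h' : ((Finset.univ.filter fun σ : ι → κ → ℤˣ => t ≤ |X σ|).card : ℝ) ≤
      (Finset.univ.filter fun σ : ι → κ → ℤˣ => t ≤ 1 * X σ).card +
      (Finset.univ.filter fun σ : ι → κ → ℤˣ => t ≤ -1 * X σ).card := by exact_mod_cast h
  linarith [hside 1 (by norm_num), hside (-1) (by norm_num)]

/-- Unit vectors `v j`, possibly far more numerous than the dimension, that behave like an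
orthonormal family on at least half of all `k`-element index sets `S`: the inner product of `v j`
with `∑ i ∈ S, v i` is within `1/8` of the indicator of `j ∈ S`. Random sign vectors have this
property. -/
theorem exists_almost_orthonormal {ι κ : Type*} [Fintype ι] [DecidableEq ι] [Fintype κ]
    [DecidableEq κ] [Nonempty κ] {k : ℕ} (hk : 0 < k)
    (h : 4 * (Fintype.card ι : ℝ) * Real.exp (-(Fintype.card κ / (128 * k))) ≤ 1) :
    ∃ (v : ι → EuclideanSpace ℝ κ) (F : Finset (Finset ι)), (∀ j, ‖v j‖ = 1) ∧
      (∀ S ∈ F, S.card = k) ∧ (Fintype.card ι).choose k ≤ 2 * F.card ∧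
      ∀ S ∈ F, ∀ j, |inner ℝ (v j) (∑ i ∈ S, v i) - if j ∈ S then 1 else 0| ≤ 1 / 8 := by
  set d := Fintype.card κ with hd
  have hd0 : (0 : ℝ) < d := by exact_mod_cast Fintype.card_pos
  have hk0 : (0 : ℝ) < k := by exact_mod_cast hk
  let P : Finset (Finset ι) := Finset.univ.powersetCard k
  let bad : (ι → κ → ℤˣ) → Finset ι → Prop := fun σ S =>
    ∃ j, (d : ℝ) / 8 ≤ |∑ i ∈ S.erase j, ∑ c, ((σ i c * σ j c : ℤˣ) : ℝ)|
  classical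
  have hbad : ∀ S ∈ P, ((Finset.univ.filter fun σ => bad σ S).card : ℝ) ≤
      Fintype.card (ι → κ → ℤˣ) / 2 := by
    intro S hS
    have hS := (Finset.mem_powersetCard.1 hS).2
    have hsub : (Finset.univ.filter fun σ => bad σ S) ⊆ Finset.univ.biUnion fun j =>
        Finset.univ.filter fun σ : ι → κ → ℤˣ =>
          (d : ℝ) / 8 ≤ |∑ i ∈ S.erase j, ∑ c, ((σ i c * σ j c : ℤˣ) : ℝ)| := by
      intro σ hσ
      obtain ⟨j, hj⟩ := (Finset.mem_filter.1 hσ).2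
      exact Finset.mem_biUnion.2 ⟨j, Finset.mem_univ _, Finset.mem_filter.2 ⟨Finset.mem_univ _, hj⟩⟩
    have h1 := (Finset.card_le_card hsub).trans Finset.card_biUnion_le
    have h2 : ((Finset.univ.filter fun σ => bad σ S).card : ℝ) ≤ ∑ j : ι,
        ((Finset.univ.filter fun σ : ι → κ → ℤˣ =>
          (d : ℝ) / 8 ≤ |∑ i ∈ S.erase j, ∑ c, ((σ i c * σ j c : ℤˣ) : ℝ)|).card : ℝ) := by
      exact_mod_cast h1
    have h3 : ∀ j : ι, ((Finset.univ.filter fun σ : ι → κ → ℤˣ =>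
          (d : ℝ) / 8 ≤ |∑ i ∈ S.erase j, ∑ c, ((σ i c * σ j c : ℤˣ) : ℝ)|).card : ℝ) ≤
        2 * Real.exp (-(d / (128 * k))) * Fintype.card (ι → κ → ℤˣ) := by
      intro j
      have := card_sign_correlation_le (κ := κ) j (S.erase j) (by simp) (t := d / 8) (a := k * d)
        (by positivity) (by positivity) (by
          gcongr
          exact (Finset.card_erase_le).trans hS.le)
      convert this using 4
      field_simp
      norm_num
    refine (h2.trans (Finset.sum_le_sum fun j _ => h3 j)).trans ?_
    rw [Finset.sum_const, Finset.card_univ, nsmul_eq_mul]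
    have h4 := mul_le_mul_of_nonneg_right h (Nat.cast_nonneg (Fintype.card (ι → κ → ℤˣ)))
    linarith
  -- Double counting of the pairs of a sign matrix and a bad index set.
  obtain ⟨σ, hσ⟩ : ∃ σ : ι → κ → ℤˣ, ((P.filter fun S => bad σ S).card : ℝ) ≤ P.card / 2 := by
    by_contra! hcon
    have h1 : ∑ σ : ι → κ → ℤˣ, (P.card : ℝ) / 2 <
        ∑ σ : ι → κ → ℤˣ, ((P.filter fun S => bad σ S).card : ℝ) :=
      Finset.sum_lt_sum_of_nonempty Finset.univ_nonempty fun σ _ => hcon σ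
    have h2 : ∑ σ : ι → κ → ℤˣ, ((P.filter fun S => bad σ S).card : ℝ) =
        ∑ S ∈ P, ((Finset.univ.filter fun σ => bad σ S).card : ℝ) := by
      exact_mod_cast Finset.sum_card_bipartiteAbove_eq_sum_card_bipartiteBelow (fun σ S => bad σ S)
    rw [h2] at h1
    have h3 := h1.trans_le (Finset.sum_le_sum hbad)
    simp only [Finset.sum_const, nsmul_eq_mul, Finset.card_univ] at h3
    linarith
  let v : ι → EuclideanSpace ℝ κ := fun i =>
    WithLp.toLp 2 fun c => ((σ i c : ℤˣ) : ℝ) / Real.sqrt d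
  have hinner : ∀ i j, inner ℝ (v j) (v i) = (∑ c, ((σ i c * σ j c : ℤˣ) : ℝ)) / d := by
    intro i j
    simp only [v, PiLp.inner_apply, RCLike.inner_apply, conj_trivial, Finset.sum_div]
    refine Finset.sum_congr rfl fun c _ => ?_
    rw [div_mul_div_comm, Real.mul_self_sqrt hd0.le]
    push_cast
    ring
  have hself : ∀ j, inner ℝ (v j) (v j) = (1 : ℝ) := fun j => by
    rw [hinner]
    simp [← hd, hd0.ne']
  refine ⟨v, P.filter fun S => ¬ bad σ S, fun j => ?_, fun S hS => ?_, ?_, fun S hS j => ?_⟩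
  · have := hself j
    rw [real_inner_self_eq_norm_sq] at this
    exact (pow_eq_one_iff_of_nonneg (norm_nonneg _) two_ne_zero).1 this
  · exact (Finset.mem_powersetCard.1 (Finset.mem_filter.1 hS).1).2
  · have h1 := Finset.card_filter_add_card_filter_not (s := P) (fun S => bad σ S)
    have h2 : P.card = (Fintype.card ι).choose k := by
      rw [Finset.card_powersetCard, Finset.card_univ]
    have h3 : 2 * (P.filter fun S => bad σ S).card ≤ P.card := by
      have : 2 * ((P.filter fun S => bad σ S).card : ℝ) ≤ P.card := by linarith
      exact_mod_cast this
    omega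
  · have hb := (Finset.mem_filter.1 hS).2
    simp only [bad, not_exists, not_le] at hb
    have h1 : inner ℝ (v j) (∑ i ∈ S, v i) - (if j ∈ S then 1 else 0) =
        (∑ i ∈ S.erase j, ∑ c, ((σ i c * σ j c : ℤˣ) : ℝ)) / d := by
      rw [Finset.sum_div, Finset.sum_congr rfl fun i _ => (hinner i j).symm, inner_sum]
      by_cases hj : j ∈ S
      · rw [← Finset.add_sum_erase _ _ hj, hself]
        simp [hj]
      · simp [hj, Finset.erase_eq_of_notMem]
    rw [h1, abs_div, abs_of_pos hd0, div_le_iff₀ hd0]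
    linarith [hb j]

/-! ### The encoding argument -/

/-- A map that preserves squared distances up to a factor `1 ± ε` preserves inner products up to an
additive error, by polarization. -/
theorem abs_inner_sub_inner_le {E F : Type*} [NormedAddCommGroup E] [InnerProductSpace ℝ E]
    [NormedAddCommGroup F] [InnerProductSpace ℝ F] {ε : ℝ} {g : E → F} {a b : E}
    (ha : |‖g a - g 0‖ ^ 2 - ‖a‖ ^ 2| ≤ ε * ‖a‖ ^ 2)
    (hb : |‖g b - g 0‖ ^ 2 - ‖b‖ ^ 2| ≤ ε * ‖b‖ ^ 2)
    (hab : |‖g a - g b‖ ^ 2 - ‖a - b‖ ^ 2| ≤ ε * ‖a - b‖ ^ 2) :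
    |inner ℝ (g a - g 0) (g b - g 0) - inner ℝ a b| ≤
      ε / 2 * (‖a‖ ^ 2 + ‖b‖ ^ 2 + ‖a - b‖ ^ 2) := by
  have h1 := norm_sub_sq_real (g a - g 0) (g b - g 0)
  have h2 := norm_sub_sq_real a b
  rw [sub_sub_sub_cancel_right] at h1
  rw [abs_le] at *
  constructor <;> linarith

/-- For fixed vectors `u j` of `ℝ^M`, at most `6 ^ M` index sets `S` can be read off, up to a
quarter of the height `η` of the indicator, from the inner products of a vector `w` with the
`u j`. -/
theorem card_decodable_le {ι E : Type*} [Fintype ι] [NormedAddCommGroup E] [InnerProductSpace ℝ E]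
    [FiniteDimensional ℝ E] {η : ℝ} (hη : 0 < η) (u : ι → E) (G : Finset (Finset ι))
    (hG : ∀ S ∈ G, ∃ w, ∀ j, (j ∈ S → |inner ℝ (u j) w - η| ≤ η / 4) ∧
      (j ∉ S → |inner ℝ (u j) w| ≤ η / 4)) :
    (G.card : ℝ) ≤ 6 ^ Module.finrank ℝ E := by
  choose! w hw using hG
  let p : ι → Seminorm ℝ E := fun j => (normSeminorm ℝ ℝ).comp (innerₛₗ ℝ (u j))
  have hpa : ∀ j x, p j x = |inner ℝ (u j) x| := fun j x => rfl
  have hpc : Continuous (Finset.univ.sup p : Seminorm ℝ E) := by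
    refine Finset.sup_induction (p := fun q : Seminorm ℝ E => Continuous q) ?_ ?_ ?_
    · simpa only [Seminorm.coe_bot] using continuous_zero
    · intro a ha b hb
      exact ha.max hb
    · intro j _
      have : (p j : E → ℝ) = fun x => |inner ℝ (u j) x| := funext (hpa j)
      rw [this]
      fun_prop
  have h := card_le_of_seminorm_separated (Finset.univ.sup p) hpc G w (r := η / 2)
    (R := 5 * η / 4) (by positivity) (by positivity) (fun S hS => ?_) fun S hS S' hS' hne => ?_
  · convert h using 2
    field_simp
    norm_num
  · refine Seminorm.finset_sup_apply_le (by positivity) fun j _ => ?_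
    rw [hpa]
    obtain ⟨h1, h2⟩ := hw S hS j
    by_cases hj : j ∈ S
    · have := h1 hj
      rw [abs_le] at *
      constructor <;> linarith
    · linarith [h2 hj]
  · obtain ⟨j, hj⟩ : ∃ j, ¬ (j ∈ S ↔ j ∈ S') := by
      by_contra! hcon
      exact hne (Finset.ext hcon)
    refine le_trans ?_ (Seminorm.le_finset_sup_apply (p := p) (Finset.mem_univ j))
    rw [hpa, inner_sub_right]
    obtain ⟨h1, h2⟩ := hw S hS j
    obtain ⟨h3, h4⟩ := hw S' hS' j
    by_cases hjS : j ∈ S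
    · have hjS' : j ∉ S' := fun h => hj (by simp [hjS, h])
      have e1 := abs_le.1 (h1 hjS)
      have e2 := abs_le.1 (h4 hjS')
      exact le_abs.2 (Or.inl (by linarith))
    · have hjS' : j ∈ S' := by_contra fun h => hj (by simp [hjS, h])
      have e1 := abs_le.1 (h2 hjS)
      have e2 := abs_le.1 (h3 hjS')
      exact le_abs.2 (Or.inr (by linarith))

/-- The vectors `v j` together with the normalized subset sums over the sets `s q` and the
origin. -/
noncomputable def hardPoints {ι κ E : Type*} [Fintype ι] [Fintype κ] [NormedAddCommGroup E]
    [NormedSpace ℝ E] [DecidableEq E] (v : ι → E) (k : ℕ) (s : κ → Finset ι) : Finset E :=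
  insert 0 (Finset.univ.image v ∪ Finset.univ.image fun q => (Real.sqrt k)⁻¹ • ∑ i ∈ s q, v i)

/-- The encoding argument. If for every `Q`-tuple of sets from `F` the point set `hardPoints`
embeds in `ℝ^M` with distortion `ε`, then every tuple is determined by a choice of
`Fintype.card ι` points of a net (the rounded images of the `v j`) and, for each of the `Q` sets,
one of `6 ^ M` alternatives. -/
theorem card_pow_le_of_embeddings {ι E : Type*} [Fintype ι] [DecidableEq ι] [NormedAddCommGroup E]
    [InnerProductSpace ℝ E] [DecidableEq E] {k M Q : ℕ} {ε : ℝ} (hε : 0 < ε) (hk : 0 < k)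
    (hkε : 48 * ε * Real.sqrt k ≤ 1) {v : ι → E} (hv : ∀ j, ‖v j‖ = 1) {F : Finset (Finset ι)}
    (hcard : ∀ S ∈ F, S.card = k)
    (hF : ∀ S ∈ F, ∀ j, |inner ℝ (v j) (∑ i ∈ S, v i) - if j ∈ S then 1 else 0| ≤ 1 / 8)
    (hemb : ∀ s : Fin Q → Finset ι, (∀ q, s q ∈ F) → ∃ g : E → EuclideanSpace ℝ (Fin M),
      ∀ x ∈ hardPoints v k s, ∀ y ∈ hardPoints v k s,
        |‖g x - g y‖ ^ 2 - ‖x - y‖ ^ 2| ≤ ε * ‖x - y‖ ^ 2) :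
    (F.card : ℝ) ^ Q ≤ ((5 / ε) ^ M) ^ Fintype.card ι * (6 ^ M) ^ Q := by
  classical
  have hk1 : (1 : ℝ) ≤ Real.sqrt k := by
    rw [Real.one_le_sqrt]; exact_mod_cast hk
  have hk0 : 0 < Real.sqrt k := by linarith
  have hε1 : 48 * ε ≤ 1 := by nlinarith
  set η : ℝ := (Real.sqrt k)⁻¹ with hη
  have hη0 : 0 < η := inv_pos.2 hk0
  have hηε : 48 * ε ≤ η := by rwa [hη, le_inv_comm₀ (by positivity) hk0, ← one_div,
    le_div_iff₀ (by positivity), mul_comm]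
  obtain ⟨T, -, -, hTnet, hTcard⟩ :=
    exists_separated_net (E := EuclideanSpace ℝ (Fin M)) hε two_pos
  rw [finrank_euclideanSpace_fin] at hTcard
  let G : (ι → EuclideanSpace ℝ (Fin M)) → Finset (Finset ι) := fun u =>
    F.filter fun S => ∃ w, ∀ j, (j ∈ S → |inner ℝ (u j) w - η| ≤ η / 4) ∧
      (j ∉ S → |inner ℝ (u j) w| ≤ η / 4)
  have hG : ∀ u, ((G u).card : ℝ) ≤ 6 ^ M := fun u => by
    have := card_decodable_le hη0 u (G u) fun S hS => (Finset.mem_filter.1 hS).2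
    rwa [finrank_euclideanSpace_fin] at this
  have hsub : Fintype.piFinset (fun _ : Fin Q => F) ⊆
      (Fintype.piFinset fun _ : ι => T).biUnion fun u => Fintype.piFinset fun _ : Fin Q => G u := by
    intro s hs
    rw [Fintype.mem_piFinset] at hs
    obtain ⟨g, hg⟩ := hemb s hs
    have h0 : (0 : E) ∈ hardPoints v k s := Finset.mem_insert_self _ _
    have hvm : ∀ j, v j ∈ hardPoints v k s := fun j =>
      Finset.mem_insert_of_mem (Finset.mem_union_left _
        (Finset.mem_image_of_mem _ (Finset.mem_univ _)))
    have hym : ∀ q, η • ∑ i ∈ s q, v i ∈ hardPoints v k s := fun q =>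
      Finset.mem_insert_of_mem (Finset.mem_union_right _
        (Finset.mem_image.2 ⟨q, Finset.mem_univ _, rfl⟩))
    have hgv : ∀ j, ‖g (v j) - g 0‖ ≤ 2 := fun j => by
      have h := hg _ (hvm j) _ h0
      rw [sub_zero, hv] at h
      have := (abs_le.1 h).2
      nlinarith [norm_nonneg (g (v j) - g 0)]
    choose u huT hu using fun j => hTnet _ (hgv j)
    refine Finset.mem_biUnion.2 ⟨u, Fintype.mem_piFinset.2 huT, Fintype.mem_piFinset.2 fun q =>
      Finset.mem_filter.2 ⟨hs q, ?_⟩⟩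
    set y : E := η • ∑ i ∈ s q, v i with hy
    have hvy : ∀ j, |inner ℝ (v j) y - if j ∈ s q then η else 0| ≤ η / 8 := fun j => by
      have h := hF _ (hs q) j
      have e : inner ℝ (v j) y - (if j ∈ s q then η else 0) =
          η * (inner ℝ (v j) (∑ i ∈ s q, v i) - if j ∈ s q then 1 else 0) := by
        rw [hy, inner_smul_right]; split_ifs <;> ring
      rw [e, abs_mul, abs_of_pos hη0]
      nlinarith
    have hkη : (k : ℝ) * η ^ 2 = 1 := by
      rw [hη, inv_pow, Real.sq_sqrt (Nat.cast_nonneg _)]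
      exact mul_inv_cancel₀ (by exact_mod_cast hk.ne')
    have hy2 : ‖y‖ ^ 2 ≤ 9 / 8 := by
      have e : ‖y‖ ^ 2 = η * ∑ j ∈ s q, inner ℝ (v j) y := by
        rw [← sum_inner, ← real_inner_self_eq_norm_sq]
        conv_lhs => rw [hy, real_inner_smul_left, ← hy]
      have b : ∑ j ∈ s q, inner ℝ (v j) y ≤ ∑ j ∈ s q, 9 / 8 * η := by
        refine Finset.sum_le_sum fun j hj => ?_
        have := (abs_le.1 (hvy j)).2
        rw [if_pos hj] at this
        linarith
      rw [Finset.sum_const, hcard _ (hs q), nsmul_eq_mul] at b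
      calc ‖y‖ ^ 2 = η * ∑ j ∈ s q, inner ℝ (v j) y := e
        _ ≤ η * (k * (9 / 8 * η)) := by gcongr
        _ = 9 / 8 * (k * η ^ 2) := by ring
        _ = 9 / 8 := by rw [hkη]; ring
    have hgy : ‖g y - g 0‖ ≤ 2 := by
      have h := hg _ (hym q) _ h0
      rw [sub_zero] at h
      have := (abs_le.1 h).2
      nlinarith [norm_nonneg (g y - g 0)]
    have hmain : ∀ j, |inner ℝ (u j) (g y - g 0) - if j ∈ s q then η else 0| ≤ η / 4 := fun j => by
      have hj0 := hg _ (hvm j) _ h0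
      have hy0 := hg _ (hym q) _ h0
      rw [sub_zero] at hj0 hy0
      have e1 := abs_inner_sub_inner_le hj0 hy0 (hg _ (hvm j) _ (hym q))
      have e2 : |inner ℝ (g (v j) - g 0 - u j) (g y - g 0)| ≤ 2 * ε := by
        refine (abs_real_inner_le_norm _ _).trans ?_
        nlinarith [hu j, norm_nonneg (g (v j) - g 0 - u j), norm_nonneg (g y - g 0)]
      have e3 : ‖v j‖ ^ 2 + ‖y‖ ^ 2 + ‖v j - y‖ ^ 2 ≤ 8 := by
        have := parallelogram_law_with_norm ℝ (v j) y
        rw [hv] at *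
        nlinarith [norm_nonneg (v j + y)]
      have e4 := hvy j
      rw [inner_sub_left] at e2
      have e5 : ε / 2 * (‖v j‖ ^ 2 + ‖y‖ ^ 2 + ‖v j - y‖ ^ 2) ≤ 4 * ε := by nlinarith
      rw [abs_le] at *
      constructor <;> linarith
    refine ⟨g y - g 0, fun j => ⟨fun hj => ?_, fun hj => ?_⟩⟩
    · simpa [hj] using hmain j
    · simpa [hj] using hmain j
  have h1 := (Finset.card_le_card hsub).trans Finset.card_biUnion_le
  simp only [Fintype.card_piFinset, Finset.prod_const, Finset.card_univ, Fintype.card_fin] at h1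
  have h2 : (F.card : ℝ) ^ Q ≤
      ∑ u ∈ Fintype.piFinset fun _ : ι => T, ((G u).card : ℝ) ^ Q := by exact_mod_cast h1
  have h3 : ∑ u ∈ Fintype.piFinset fun _ : ι => T, ((G u).card : ℝ) ^ Q ≤
      ∑ u ∈ Fintype.piFinset fun _ : ι => T, ((6 : ℝ) ^ M) ^ Q :=
    Finset.sum_le_sum fun u _ => pow_le_pow_left₀ (Nat.cast_nonneg _) (hG u) _
  refine h2.trans (h3.trans ?_)
  rw [Finset.sum_const, Fintype.card_piFinset, Finset.prod_const, Finset.card_univ, nsmul_eq_mul]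
  push_cast
  gcongr
  refine hTcard.trans ?_
  gcongr
  rw [le_div_iff₀ hε, add_mul, div_mul_cancel₀ _ hε.ne']
  linarith

/-! ### The range of the parameters -/

/-- Consequences of the lower bound on `ε`. The exponent `1 / 5001` is `1 - 1 / 1.0002`; it
measures how far `ε ^ 2 * n` is above `lg n`. -/
theorem consequences_of_lower_bound {n d : ℕ} {ε : ℝ} (hn : 2 ≤ n) (hd : 2 ≤ d)
    (h : Real.logb 2 n ^ (0.5001 : ℝ) / Real.sqrt ((min n d : ℕ) : ℝ) < ε) :
    0 < ε ∧ 1 ≤ Real.logb 2 n ∧ Real.logb 2 n < ε ^ 2 * n ∧ Real.logb 2 n < ε ^ 2 * d ∧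
      1 < ε ^ 2 * n ∧ (ε ^ 2 * n) ^ (1 / 5001 : ℝ) * Real.logb 2 n ≤ ε ^ 2 * n := by
  set L := Real.logb 2 n with hL
  have hn' : (2 : ℝ) ≤ n := by exact_mod_cast hn
  have hL1 : 1 ≤ L := by
    rw [hL, Real.le_logb_iff_rpow_le one_lt_two (by linarith), Real.rpow_one]
    exact hn'
  have hL0 : 0 < L := by linarith
  have hmin : (0 : ℝ) < (min n d : ℕ) := by
    have : 0 < min n d := by omega
    exact_mod_cast this
  have hε : 0 < ε := lt_of_le_of_lt (by positivity) h
  rw [div_lt_iff₀ (Real.sqrt_pos.2 hmin)] at h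
  have hsq : L ^ (1.0002 : ℝ) < ε ^ 2 * (min n d : ℕ) := by
    have h1 := pow_lt_pow_left₀ h (by positivity) two_ne_zero
    rw [mul_pow, Real.sq_sqrt hmin.le, ← Real.rpow_natCast, ← Real.rpow_mul hL0.le] at h1
    norm_num at h1 ⊢
    exact h1
  have hLpow : L ≤ L ^ (1.0002 : ℝ) := by
    conv_lhs => rw [← Real.rpow_one L]
    exact Real.rpow_le_rpow_of_exponent_le hL1 (by norm_num)
  have hminn : ((min n d : ℕ) : ℝ) ≤ n := by exact_mod_cast min_le_left n d
  have hmind : ((min n d : ℕ) : ℝ) ≤ d := by exact_mod_cast min_le_right n d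
  have hzn : L ^ (1.0002 : ℝ) < ε ^ 2 * n := hsq.trans_le (by gcongr)
  have hzd : L ^ (1.0002 : ℝ) < ε ^ 2 * d := hsq.trans_le (by gcongr)
  have hz1 : 1 < ε ^ 2 * n := by linarith
  refine ⟨hε, hL1, by linarith, by linarith, hz1, ?_⟩
  have hz0 : 0 < ε ^ 2 * n := by linarith
  have h3 : L ≤ (ε ^ 2 * n) ^ (5000 / 5001 : ℝ) := by
    have h4 := Real.rpow_le_rpow (by positivity) hzn.le (by norm_num : (0 : ℝ) ≤ 5000 / 5001)
    rw [← Real.rpow_mul hL0.le] at h4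
    norm_num at h4
    exact h4
  calc (ε ^ 2 * n) ^ (1 / 5001 : ℝ) * L
      ≤ (ε ^ 2 * n) ^ (1 / 5001 : ℝ) * (ε ^ 2 * n) ^ (5000 / 5001 : ℝ) := by gcongr
    _ = ε ^ 2 * n := by rw [← Real.rpow_add hz0]; norm_num

/-! ### Distance-preserving maps between Euclidean spaces -/

/-- Euclidean spaces of smaller dimension embed isometrically in those of larger dimension. -/
theorem exists_isometric_padding {m M : ℕ} (h : m ≤ M) :
    ∃ φ : EuclideanSpace ℝ (Fin m) → EuclideanSpace ℝ (Fin M),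
      ∀ x y, ‖φ x - φ y‖ = ‖x - y‖ := by
  obtain ⟨r, rfl⟩ := Nat.exists_eq_add_of_le h
  refine ⟨fun x => WithLp.toLp 2 (Fin.append (fun i => x i) 0), fun x y => ?_⟩
  rw [EuclideanSpace.norm_eq, EuclideanSpace.norm_eq, Fin.sum_univ_add]
  simp

theorem abs_norm_sq_sub_le_of_preservesDistances {d m : ℕ}
    {X : Finset (EuclideanSpace ℝ (Fin d))} {ε : ℝ} {f : X → EuclideanSpace ℝ (Fin m)}
    (hf : PreservesDistances X ε f) (x y : X) :
    |‖f x - f y‖ ^ 2 - ‖(x : EuclideanSpace ℝ (Fin d)) - y‖ ^ 2| ≤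
      ε * ‖(x : EuclideanSpace ℝ (Fin d)) - y‖ ^ 2 := by
  obtain ⟨h1, h2⟩ := hf x y
  rw [abs_le]
  constructor <;> linarith

/-! ### Distortion bounded away from `0` -/

/-- The bound for `1 / 48 < ε ≤ ε₀`: `n` points at mutual distance at least `1` in a ball of
radius `2` are mapped to separated points of a ball, so `n` is at most exponential in `m`. -/
theorem exists_hard_set_of_large {ε₀ : ℝ} (hε₀ : ε₀ < 1) : ∃ c : ℝ, 0 < c ∧
    ∀ (n d : ℕ) (ε : ℝ), 2 ≤ n → Real.logb 2 n ≤ d → 0 < ε → 1 / 48 < ε → ε ≤ ε₀ →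
      ∃ X : Finset (EuclideanSpace ℝ (Fin d)), X.card = n ∧
        ∀ (m : ℕ) (f : X → EuclideanSpace ℝ (Fin m)), PreservesDistances X ε f →
          c * ((ε ^ 2)⁻¹ * Real.logb 2 (ε ^ 2 * n)) ≤ m := by
  set r := Real.sqrt (1 - ε₀) with hr
  have hr0 : 0 < r := Real.sqrt_pos.2 (by linarith)
  have hr2 : r ^ 2 = 1 - ε₀ := Real.sq_sqrt (by linarith)
  set B := 1 + 2 * 6 / r with hB
  have hB1 : 1 < B := by rw [hB]; linarith [div_pos (by norm_num : (0 : ℝ) < 2 * 6) hr0]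
  have hlB : 0 < Real.logb 2 B := Real.logb_pos one_lt_two hB1
  refine ⟨(2304 * Real.logb 2 B)⁻¹, by positivity, fun n d ε hn hd hε hε1 hε2 => ?_⟩
  have hn' : (2 : ℝ) ≤ n := by exact_mod_cast hn
  obtain ⟨T, hT1, hT2, hT3⟩ := exists_separated_card_ge (EuclideanSpace ℝ (Fin d))
  rw [finrank_euclideanSpace_fin] at hT3
  have hnT : n ≤ T.card := by
    refine le_trans ?_ hT3
    rw [Real.logb_le_iff_le_rpow one_lt_two (by linarith), Real.rpow_natCast] at hd
    exact_mod_cast hd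
  obtain ⟨X, hXT, hX⟩ := Finset.exists_subset_card_eq hnT
  refine ⟨X, hX, fun m f hf => ?_⟩
  obtain ⟨x₀, hx₀⟩ : X.Nonempty := Finset.card_pos.1 (by omega)
  have hcard := card_le_of_seminorm_separated (normSeminorm ℝ (EuclideanSpace ℝ (Fin m)))
    continuous_norm Finset.univ (fun x : X => f x - f ⟨x₀, hx₀⟩) hr0 (by norm_num : (0 : ℝ) < 6)
    (fun x _ => by
      simp only [coe_normSeminorm]
      have h1 := (hf x ⟨x₀, hx₀⟩).2
      have h2 : ‖(x : EuclideanSpace ℝ (Fin d)) - x₀‖ ≤ 4 :=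
        (norm_sub_le _ _).trans (by linarith [hT1 _ (hXT x.2), hT1 _ (hXT hx₀)])
      have h3 : ‖(x : EuclideanSpace ℝ (Fin d)) - x₀‖ ^ 2 ≤ 4 ^ 2 := by gcongr
      simp only at h1
      nlinarith [norm_nonneg (f x - f ⟨x₀, hx₀⟩)])
    (fun x _ y _ hxy => by
      simp only [coe_normSeminorm, sub_sub_sub_cancel_right]
      have h1 := (hf x y).1
      have h2 := hT2 _ (hXT x.2) _ (hXT y.2) fun h => hxy (Subtype.ext h)
      have h3 : 1 ≤ ‖(x : EuclideanSpace ℝ (Fin d)) - y‖ ^ 2 := by nlinarith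
      refine le_of_sq_le_sq ?_ (norm_nonneg _)
      rw [hr2]
      nlinarith)
  rw [Finset.card_univ, Fintype.card_coe, hX, finrank_euclideanSpace_fin, ← hB] at hcard
  have h4 : Real.logb 2 n ≤ m * Real.logb 2 B := by
    rw [← Real.logb_pow]
    exact Real.logb_le_logb_of_le one_lt_two (by linarith) hcard
  have h5 : Real.logb 2 (ε ^ 2 * n) ≤ Real.logb 2 n := by
    refine Real.logb_le_logb_of_le one_lt_two (by positivity) ?_
    have : ε ^ 2 ≤ 1 := by nlinarith
    nlinarith
  have h6 : (ε ^ 2)⁻¹ ≤ 2304 := by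
    rw [inv_le_comm₀ (by positivity) (by norm_num)]
    nlinarith
  have h7 : 0 ≤ Real.logb 2 n := Real.logb_nonneg one_lt_two (by linarith)
  rw [inv_mul_le_iff₀ (by positivity)]
  calc (ε ^ 2)⁻¹ * Real.logb 2 (ε ^ 2 * n) ≤ (ε ^ 2)⁻¹ * Real.logb 2 n := by gcongr
    _ ≤ 2304 * (m * Real.logb 2 B) := by gcongr
    _ = 2304 * Real.logb 2 B * m := by ring

/-! ### Small distortion -/

theorem pow_le_choose_of_two_mul_le {N k : ℕ} {a : ℝ} (ha : 1 ≤ a) (h : 2 * a * k ≤ N) :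
    a ^ k ≤ (N.choose k : ℝ) := by
  refine le_trans ?_ (Nat.pow_le_choose k N)
  rw [le_div_iff₀ (by positivity)]
  have h1 : (k.factorial : ℝ) ≤ (k : ℝ) ^ k := by exact_mod_cast Nat.factorial_le_pow k
  have h0 : (0 : ℝ) ≤ k := Nat.cast_nonneg k
  have h2 : (k : ℝ) ≤ a * k := le_mul_of_one_le_left h0 ha
  have hkN : k ≤ N := by
    have : (k : ℝ) ≤ N := by linarith
    exact_mod_cast this
  have h3 : a * k ≤ ((N + 1 - k : ℕ) : ℝ) := by
    rw [Nat.cast_sub (by omega)]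
    push_cast
    linarith
  calc a ^ k * (k.factorial : ℝ) ≤ a ^ k * (k : ℝ) ^ k := by gcongr
    _ = (a * k) ^ k := (mul_pow _ _ _).symm
    _ ≤ ((N + 1 - k : ℕ) : ℝ) ^ k := by gcongr

set_option maxHeartbeats 400000 in
/-- The bound for small `ε`: if every set of `n` points of `ℝ^d` embeds in
`ℝ^M` with distortion `ε`, then `M` is large. -/
theorem lt_of_forall_embedding {n d M : ℕ} {ε : ℝ} (hn : 2 ≤ n) (hd : 2 ≤ d)
    (h : Real.logb 2 n ^ (0.5001 : ℝ) / Real.sqrt ((min n d : ℕ) : ℝ) < ε) (hε48 : ε ≤ 1 / 48)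
    (hemb : ∀ X : Finset (EuclideanSpace ℝ (Fin d)), X.card = n →
      ∃ g : EuclideanSpace ℝ (Fin d) → EuclideanSpace ℝ (Fin M), ∀ x ∈ X, ∀ y ∈ X,
        |‖g x - g y‖ ^ 2 - ‖x - y‖ ^ 2| ≤ ε * ‖x - y‖ ^ 2) :
    (4608 * 20004 : ℝ)⁻¹ * ((ε ^ 2)⁻¹ * Real.logb 2 (ε ^ 2 * n)) < M := by
  classical
  obtain ⟨hε, hL1, hLn, hLd, hz1, hyz⟩ := consequences_of_lower_bound hn hd h
  set L := Real.logb 2 n with hL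
  set z := ε ^ 2 * n with hz
  have hn0 : (0 : ℝ) < n := by exact_mod_cast (by omega : 0 < n)
  have hL0 : 0 < L := by linarith
  have hε2 : 0 < ε ^ 2 := by positivity
  have hεi : 2304 ≤ (ε ^ 2)⁻¹ := by
    rw [le_inv_comm₀ (by norm_num) hε2]
    nlinarith
  have hnL : (ε ^ 2)⁻¹ < n / L := by
    rw [lt_div_iff₀ hL0, inv_mul_lt_iff₀ hε2]
    exact hLn
  have hn2304 : (2304 : ℝ) ≤ n := by
    have : (n : ℝ) / L ≤ n := div_le_self hn0.le hL1
    linarith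
  -- The size of the index sets, the number of vectors `v j`, and the number of subset sums.
  obtain ⟨k, hk⟩ : ∃ k, k = ⌊(ε ^ 2)⁻¹ / 2304⌋₊ := ⟨_, rfl⟩
  obtain ⟨N, hN⟩ : ∃ N, N = ⌊(n : ℝ) / (4 * L)⌋₊ := ⟨_, rfl⟩
  obtain ⟨Q, hQ⟩ : ∃ Q, Q = n / 2 := ⟨_, rfl⟩
  have hk1 : 0 < k := by
    rw [hk]
    exact Nat.floor_pos.2 (by linarith)
  have hk1' : (1 : ℝ) ≤ k := by exact_mod_cast hk1
  have hkle : (k : ℝ) ≤ (ε ^ 2)⁻¹ / 2304 := hk ▸ Nat.floor_le (by positivity)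
  have hkge : (ε ^ 2)⁻¹ / 4608 ≤ k := by
    have := Nat.lt_floor_add_one ((ε ^ 2)⁻¹ / 2304)
    rw [← hk] at this
    linarith
  have hkz : 2304 * ε ^ 2 * k ≤ 1 := by
    calc 2304 * ε ^ 2 * k ≤ 2304 * ε ^ 2 * ((ε ^ 2)⁻¹ / 2304) := by gcongr
      _ = 1 := by field_simp
  have hkε : 48 * ε * Real.sqrt k ≤ 1 := by
    refine le_of_sq_le_sq ?_ zero_le_one
    rw [mul_pow, mul_pow, Real.sq_sqrt (by positivity)]
    linarith
  have hnL4 : (n : ℝ) / (4 * L) = n / L / 4 := by field_simp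
  have hNle : (N : ℝ) ≤ n / (4 * L) := hN ▸ Nat.floor_le (by positivity)
  have hNL : (N : ℝ) * L ≤ n / 4 := by
    calc (N : ℝ) * L ≤ n / (4 * L) * L := by gcongr
      _ = n / 4 := by field_simp
  have hNn : (N : ℝ) ≤ n / 4 := by nlinarith
  have hNge : (n : ℝ) / L / 8 ≤ N := by
    have := Nat.lt_floor_add_one ((n : ℝ) / (4 * L))
    rw [← hN, hnL4] at this
    linarith
  have hNn' : 4 * N ≤ n := by
    have : (4 : ℝ) * N ≤ n := by linarith
    exact_mod_cast this
  have hn4 : 2304 ≤ n := by exact_mod_cast hn2304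
  have hexp : 4 * (Fintype.card (Fin N) : ℝ) *
      Real.exp (-(Fintype.card (Fin d) / (128 * k))) ≤ 1 := by
    rw [Fintype.card_fin, Fintype.card_fin, Real.exp_neg, ← div_eq_mul_inv,
      div_le_one (Real.exp_pos _)]
    have hlog : Real.log n ≤ L := by
      rw [hL, Real.logb, le_div_iff₀ (Real.log_pos one_lt_two)]
      have h1 := Real.log_two_lt_d9
      have h2 : 0 ≤ Real.log n := Real.log_nonneg (by linarith)
      nlinarith
    have h1 : L ≤ d / (128 * k) := by
      rw [le_div_iff₀ (by positivity)]
      have h3 : L * (128 * k) ≤ ε ^ 2 * d * (128 * k) := by gcongr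
      have h4 : (2304 * ε ^ 2 * k) * d ≤ 1 * d := by gcongr
      have h5 : (0 : ℝ) ≤ d := Nat.cast_nonneg d
      linarith
    calc (4 : ℝ) * N ≤ n := by linarith
      _ = Real.exp (Real.log n) := (Real.exp_log hn0).symm
      _ ≤ _ := Real.exp_le_exp.2 (hlog.trans h1)
  have : Nonempty (Fin d) := ⟨⟨0, by omega⟩⟩
  obtain ⟨v, F, hv, hFk, hFcard, hF⟩ :=
    exists_almost_orthonormal (ι := Fin N) (κ := Fin d) hk1 hexp
  rw [Fintype.card_fin] at hFcard
  have hmain := card_pow_le_of_embeddings (M := M) (Q := Q) hε hk1 hkε hv hFk hF (fun s hs => by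
    have hc : (hardPoints v k s).card ≤ n := by
      refine (Finset.card_insert_le _ _).trans ?_
      have h1 := Finset.card_union_le (Finset.univ.image v)
        (Finset.univ.image fun q => (Real.sqrt k)⁻¹ • ∑ i ∈ s q, v i)
      have h2 : (Finset.univ.image v).card ≤ N := Finset.card_image_le.trans (by simp)
      have h3 : (Finset.univ.image fun q => (Real.sqrt k)⁻¹ • ∑ i ∈ s q, v i).card ≤ Q :=
        Finset.card_image_le.trans (by simp)
      omega
    have : Infinite (EuclideanSpace ℝ (Fin d)) := Module.Free.infinite ℝ _
    obtain ⟨X, hX1, hX2⟩ := Infinite.exists_superset_card_eq _ n hc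
    obtain ⟨g, hg⟩ := hemb X hX2
    exact ⟨g, fun x hx y hy => hg x (hX1 hx) y (hX1 hy)⟩)
  rw [Fintype.card_fin] at hmain
  -- The net of the rounded images costs no more than the `Q` subset sums.
  have hnet : (5 / ε) ^ N ≤ (2 : ℝ) ^ Q := by
    have h1 : 5 / ε ≤ n := by
      refine le_of_sq_le_sq ?_ hn0.le
      have h2 : (ε ^ 2)⁻¹ ≤ n := by
        have : (n : ℝ) / L ≤ n := div_le_self hn0.le hL1
        linarith
      rw [div_pow, div_eq_mul_inv]
      nlinarith
    have h3 : (n : ℝ) = 2 ^ L := (Real.rpow_logb two_pos (by norm_num) hn0).symm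
    calc (5 / ε) ^ N ≤ (n : ℝ) ^ N := by gcongr
      _ = 2 ^ (L * N) := by rw [Real.rpow_mul two_pos.le, ← h3, Real.rpow_natCast]
      _ ≤ 2 ^ (Q : ℝ) := by
        refine Real.rpow_le_rpow_of_exponent_le one_le_two ?_
        have : n ≤ 4 * Q := by omega
        have : (n : ℝ) ≤ 4 * Q := by exact_mod_cast this
        linarith
      _ = 2 ^ Q := Real.rpow_natCast _ _
  have hF12 : (F.card : ℝ) ≤ 12 ^ M := by
    have hQ0 : Q ≠ 0 := by omega
    refine (pow_le_pow_iff_left₀ (Nat.cast_nonneg _) (by positivity) hQ0).1 (hmain.trans ?_)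
    calc ((5 / ε) ^ M) ^ N * ((6 : ℝ) ^ M) ^ Q = ((5 / ε) ^ N) ^ M * ((6 : ℝ) ^ M) ^ Q := by
          rw [pow_right_comm]
      _ ≤ ((2 : ℝ) ^ Q) ^ M * ((6 : ℝ) ^ M) ^ Q := by gcongr
      _ = (12 ^ M) ^ Q := by
        rw [← pow_mul, mul_comm Q M, pow_mul, ← mul_pow, ← mul_pow]; norm_num
  set y := z ^ (1 / 5001 : ℝ) with hy
  have hy1 : 1 ≤ y := Real.one_le_rpow hz1.le (by norm_num)
  have hNk : 288 * y * k ≤ N := by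
    refine le_trans ?_ hNge
    have h1 : y ≤ z / L := by rwa [le_div_iff₀ hL0]
    calc 288 * y * k ≤ 288 * (z / L) * k := by gcongr
      _ = (2304 * ε ^ 2 * k) * (n / L / 8) := by rw [hz]; ring
      _ ≤ 1 * (n / L / 8) := by gcongr
      _ = _ := one_mul _
  have hchoose : (144 * y) ^ k ≤ (N.choose k : ℝ) :=
    pow_le_choose_of_two_mul_le (by linarith) (by linarith)
  have hyM : y ^ k < (12 : ℝ) ^ M := by
    have h1 : (N.choose k : ℝ) ≤ 2 * F.card := by exact_mod_cast hFcard
    have h2 : (144 : ℝ) ≤ 144 ^ k := le_self_pow₀ (by norm_num) hk1.ne'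
    have h3 : 0 < y ^ k := by positivity
    have h4 : 144 * y ^ k ≤ 144 ^ k * y ^ k := mul_le_mul_of_nonneg_right h2 h3.le
    rw [mul_pow] at hchoose
    linarith
  have hz0 : 0 < z := by linarith
  have hlog : k * (1 / 5001 * Real.logb 2 z) < M * 4 := by
    have h1 := Real.logb_lt_logb one_lt_two (by positivity) hyM
    rw [Real.logb_pow, Real.logb_pow, hy, Real.logb_rpow_eq_mul_logb_of_pos hz0] at h1
    refine h1.trans_le ?_
    gcongr
    rw [Real.logb_le_iff_le_rpow one_lt_two (by norm_num)]
    norm_num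
  have hlz : 0 ≤ Real.logb 2 z := Real.logb_nonneg one_lt_two hz1.le
  have := mul_le_mul_of_nonneg_right hkge hlz
  calc (4608 * 20004 : ℝ)⁻¹ * ((ε ^ 2)⁻¹ * Real.logb 2 z)
      = ((ε ^ 2)⁻¹ / 4608 * Real.logb 2 z) / 20004 := by ring
    _ < M := by linarith

/-! ### The lower bound -/

theorem theorem1 :
    ∀ ε₀ : ℝ, ε₀ < 1 → ∃ c : ℝ, 0 < c ∧
      ∀ (n d : ℕ) (ε : ℝ), 2 ≤ n → 2 ≤ d →
        (Real.logb 2 (n : ℝ)) ^ (0.5001 : ℝ) / Real.sqrt ((min n d : ℕ) : ℝ) < ε → ε ≤ ε₀ →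
        ∃ X : Finset (EuclideanSpace ℝ (Fin d)), X.card = n ∧
          ∀ (m : ℕ) (f : X → EuclideanSpace ℝ (Fin m)), PreservesDistances X ε f →
            c * ((ε ^ 2)⁻¹ * Real.logb 2 (ε ^ 2 * (n : ℝ))) ≤ (m : ℝ) := by
  intro ε₀ hε₀
  obtain ⟨c, hc, hlarge⟩ := exists_hard_set_of_large hε₀
  refine ⟨min c (4608 * 20004 : ℝ)⁻¹, by positivity, fun n d ε hn hd h hε => ?_⟩
  obtain ⟨hε0, -, -, hLd, hz1, -⟩ := consequences_of_lower_bound hn hd h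
  have hB : 0 ≤ (ε ^ 2)⁻¹ * Real.logb 2 (ε ^ 2 * n) :=
    mul_nonneg (by positivity) (Real.logb_nonneg one_lt_two hz1.le)
  rcases lt_or_ge (1 / 48) ε with hε48 | hε48
  · have hd' : Real.logb 2 n ≤ d := by
      have : ε ^ 2 ≤ 1 := by nlinarith
      nlinarith [(Nat.cast_nonneg d : (0 : ℝ) ≤ d)]
    obtain ⟨X, hX, hf⟩ := hlarge n d ε hn hd' hε0 hε48 hε
    exact ⟨X, hX, fun m f hpd => (mul_le_mul_of_nonneg_right (min_le_left _ _) hB).trans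
      (hf m f hpd)⟩
  · by_contra! hcon
    set b := (4608 * 20004 : ℝ)⁻¹ * ((ε ^ 2)⁻¹ * Real.logb 2 (ε ^ 2 * n)) with hb
    have hb0 : 0 ≤ b := by positivity
    refine absurd (lt_of_forall_embedding (M := ⌊b⌋₊) hn hd h hε48 fun X hX => ?_)
      (not_lt.2 (Nat.floor_le hb0))
    obtain ⟨m, f, hf, hm⟩ := hcon X hX
    have hmb : (m : ℝ) ≤ b :=
      hm.le.trans (mul_le_mul_of_nonneg_right (min_le_right _ _) hB)
    obtain ⟨φ, hφ⟩ := exists_isometric_padding (Nat.le_floor hmb)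
    classical
    refine ⟨fun x => if hx : x ∈ X then φ (f ⟨x, hx⟩) else 0, fun x hx y hy => ?_⟩
    simp only [hx, hy, dif_pos, hφ]
    exact abs_norm_sq_sub_le_of_preservesDistances hf ⟨x, hx⟩ ⟨y, hy⟩
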